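/- Let $n\ge 3$ and let $\mathcal G=(\mathcal V,\mathcal E,\mathcal A)$ be a graph with vertex set $\mathcal V=\{1,\dots,n\}$, a set $\mathcal E$ of undirected edges without loops, and a set $\mathcal A$ of triples $(k,i,j)$ of distinct vertices with $(i,k),(j,k)\in\mathcal E$; the triple $(k,i,j)$ prescribes the angle $\theta^k_{ij}\in[0,\pi]$ at $k$ subtended by the adjacent edges $(i,k)$ and $(j,k)$. For a configuration $\mathbf p=(\mathbf p_1,\dots,\mathbf p_n)\in\mathbb R^{3n}$, $\mathbf p_i\in\mathbb R^3$, the framework $(\mathcal G,\mathbf p)$ is *strongly equivalent* to $(\mathcal G,\mathbf q)$ if $\|\mathbf p_v-\mathbf p_w\|=\|\mathbf q_v-\mathbf q_w\|$ for all $(v,w)\in\mathcal E$ and the angle $\theta^k_{ij}$ is the same in both frameworks for all $(k,i,j)\in\mathcal A$. It is *weakly rigid* in $\mathbb R^3$ if $\mathbf p$ has a neighborhood $\mathcal B_{\mathbf p}\subseteq\mathbb R^{3n}$ such that every $\mathbf q\in\mathcal B_{\mathbf p}$ for which $(\mathcal G,\mathbf q)$ is strongly equivalent to $(\mathcal G,\mathbf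 p)$ satisfies $\|\mathbf p_i-\mathbf p_j\|=\|\mathbf q_i-\mathbf q_j\|$ for all $i,j\in\mathcal V$. Let $\bar{\mathcal G}$ be the graph with vertex set $\mathcal V$, with edge set $$\bar{\mathcal E}=\{(i,j) : (i,j)\in\mathcal E \text{ or } (k,i,j)\in\mathcal A \text{ for some } k\in\mathcal V\}$$ (undirected edges) and with no angles. Its *rigidity matrix* at $\mathbf p$ is $R_D(\mathbf p)=\frac12\,\frac{\partial F_D(\mathbf p)}{\partial\mathbf p}\in\mathbb R^{|\bar{\mathcal E}|\times 3n}$, where $F_D(\mathbf p)=\left(\|\mathbf p_i-\mathbf p_j\|^2\right)_{(i,j)\in\bar{\mathcal E}}$. If $\mathbf p$ is generic, i.e. the $3n$ coordinates of its points are algebraically independent over $\mathbb Q$, then $(\mathcal G,\mathbf p)$ is weakly rigid in $\mathbb R^3$ if and only if the rigidity matrix $R_D(\mathbf p)$ of $(\bar{\mathcal G},\mathbf p)$ has rank $3n-6$. -/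

import Mathlib

open scoped Topology

noncomputable section

/-- A graph `(V, E, A)` with vertex set `V = Fin n`, undirected edges `E` without loops, and a set
`A` of triples `(k, i, j)`: the angle at the vertex `k` subtended by `i` and `j`. The pairs `(i, k)`
and `(j, k)` are edges of the complete graph on `V`, and `i`, `j` are different. -/
structure AngleGraph (n : ℕ) where
  edges : SimpleGraph (Fin n)
  angles : Set (Fin n × Fin n × Fin n)
  angles_distinct : ∀ k i j, (k, i, j) ∈ angles → i ≠ k ∧ j ≠ k ∧ i ≠ j

/-- Configurations of `n` points in `ℝ^d`, that is, elements of `ℝ^{dn}`. -/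
abbrev Configuration (d n : ℕ) : Type := Fin n → EuclideanSpace ℝ (Fin d)

namespace AngleGraph

variable {d n : ℕ}

/-- Every angle constraint is subtended by two adjacent edges of the graph. -/
def AnglesOnEdges (G : AngleGraph n) : Prop :=
  ∀ k i j, (k, i, j) ∈ G.angles → G.edges.Adj i k ∧ G.edges.Adj j k

/-- `(G, p)` and `(G, q)` are strongly equivalent: all edge lengths and all angles in the angle set
agree. -/
def StronglyEquivalent (G : AngleGraph n) (p q : Configuration d n) : Prop :=
  (∀ v w, G.edges.Adj v w → ‖p v - p w‖ = ‖q v - q w‖) ∧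
    ∀ k i j, (k, i, j) ∈ G.angles →
      EuclideanGeometry.angle (p i) (p k) (p j) = EuclideanGeometry.angle (q i) (q k) (q j)

/-- `(G, p)` is weakly rigid: every framework `(G, q)` with `q` near `p` that is strongly equivalent
to `(G, p)` is congruent to `(G, p)`. -/
def WeaklyRigid (G : AngleGraph n) (p : Configuration d n) : Prop :=
  ∃ B ∈ 𝓝 p, ∀ q ∈ B, G.StronglyEquivalent p q → ∀ i j, ‖p i - p j‖ = ‖q i - q j‖

/-- The graph induced from `G`: the same vertices, the edges of `G` together with a new edge `(i, j)`
for each angle `(k, i, j)` of `G`, and no angles. -/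
def induced (G : AngleGraph n) : AngleGraph n where
  edges := SimpleGraph.fromRel fun i j => G.edges.Adj i j ∨ ∃ k, (k, i, j) ∈ G.angles
  angles := ∅
  angles_distinct := by intro k i j h; exact absurd h (Set.notMem_empty _)

/-- The rigidity function: the squared lengths of the edges. -/
def rigidityFunction (G : AngleGraph n) (p : Configuration d n) : G.edges.edgeSet → ℝ :=
  fun e => Sym2.lift ⟨fun i j => ‖p i - p j‖ ^ 2, fun i j => by simp only [norm_sub_rev]⟩ e.1

/-- The rigidity matrix: one half of the Jacobian matrix of the rigidity function. The rows are
indexed by the edges, the columns by the coordinates of the configuration. -/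
def rigidityMatrix (G : AngleGraph n) (p : Configuration d n) :
    Matrix G.edges.edgeSet (Fin n × Fin d) ℝ :=
  Matrix.of fun e c =>
    (1 / 2 : ℝ) * fderiv ℝ (fun q : Configuration d n => G.rigidityFunction q e) p
      (Pi.single c.1 (EuclideanSpace.single c.2 1))

end AngleGraph

/-- The configuration is generic: the coordinates of its points are algebraically independent over
the rationals. -/
def Configuration.IsGeneric {d n : ℕ} (p : Configuration d n) : Prop :=
  AlgebraicIndependent ℚ fun c : Fin n × Fin d => p c.1 c.2

end

/-! By the law of cosines, once the two sides at `k` are fixed, the angle at `k` and the third side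
determine each other. Weak rigidity is therefore local rigidity of the bar framework on the induced
graph `H`, and what remains is the Asimow–Roth argument: compare the infinitesimal flexes of `H`
with those of the complete graph `K`. Rigidity matrices have polynomial entries over `ℚ`, so a
generic `p` maximises the rank for `H` and for `K`; for `K` the maximum is `3n - 6`
(`rank_complete_of_isGeneric`). If the ranks agree at `p`, the kernels agree near `p`, and the
midpoint identity `rigidityFunction_eq_iff` turns this into rigidity
(`eventually_rigid_of_rank_eq`). Conversely, maximal rank lets every flex of `H` be realised by a
curve with constant `H`-lengths (`exists_curve_in_fibre`); rigidity makes all distances constant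
along it, so the flex is one of `K` (`rank_eq_of_eventually_rigid`). -/

noncomputable section

/-! ### Curves in the fibres of a map of locally maximal rank -/

section ConstantRank

open Filter

variable {E F : Type*} [NormedAddCommGroup E] [NormedSpace ℝ E] [FiniteDimensional ℝ E]
  [NormedAddCommGroup F] [NormedSpace ℝ F]

/-- The rank of a continuously varying linear map does not drop locally. -/
theorem eventually_finrank_range_le {X : Type*} [TopologicalSpace X] {T : X → E →L[ℝ] F} {a : X}
    (hT : ContinuousAt T a) :
    ∀ᶠ x in 𝓝 a, Module.finrank ℝ (T a : E →ₗ[ℝ] F).range ≤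
      Module.finrank ℝ (T x : E →ₗ[ℝ] F).range := by
  have ho := isOpen_setOfPred_nat_le_rank (𝕜 := ℝ) (E := E) (F := F)
    (Module.finrank ℝ (T a : E →ₗ[ℝ] F).range)
  have ha : T a ∈ {f : E →L[ℝ] F |
      (Module.finrank ℝ (T a : E →ₗ[ℝ] F).range : Cardinal) ≤ (f : E →ₗ[ℝ] F).rank} := by
    simp [LinearMap.rank]
  filter_upwards [hT (ho.mem_nhds ha)] with x hx
  have hx' : (Module.finrank ℝ (T a : E →ₗ[ℝ] F).range : Cardinal) ≤
    (T x : E →ₗ[ℝ] F).rank := hx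
  rw [LinearMap.rank, ← Module.finrank_eq_rank] at hx'
  exact_mod_cast hx'

/-- Every linear map over a field has a generalized inverse. -/
theorem LinearMap.exists_comp_comp_eq_self {K V W : Type*} [Field K] [AddCommGroup V] [Module K V]
    [AddCommGroup W] [Module K W] (L : V →ₗ[K] W) : ∃ J : W →ₗ[K] V, L ∘ₗ J ∘ₗ L = L := by
  obtain ⟨g, hg⟩ := L.rangeRestrict.exists_rightInverse_of_surjective L.range_rangeRestrict
  obtain ⟨J, hJ⟩ := LinearMap.exists_extend g
  refine ⟨J, LinearMap.ext fun x => ?_⟩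
  have h1 : J (L x) = g (L.rangeRestrict x) := by rw [← hJ]; rfl
  have h2 := congrArg Subtype.val (LinearMap.congr_fun hg (L.rangeRestrict x))
  simp only [LinearMap.comp_apply, h1]
  exact h2

/-- A linear map whose rank does not drop after composition keeps its kernel. -/
theorem LinearMap.ker_comp_eq_of_finrank_range_le {K V W U : Type*} [Field K] [AddCommGroup V]
    [Module K V] [FiniteDimensional K V] [AddCommGroup W] [Module K W] [AddCommGroup U] [Module K U]
    (f : V →ₗ[K] W) (g : W →ₗ[K] U)
    (h : Module.finrank K f.range ≤ Module.finrank K (g ∘ₗ f).range) : (g ∘ₗ f).ker = f.ker := by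
  symm
  refine Submodule.eq_of_le_of_finrank_le (LinearMap.ker_le_ker_comp f g) ?_
  have h1 := f.finrank_range_add_finrank_ker
  have h2 := (g ∘ₗ f).finrank_range_add_finrank_ker
  omega

/-- Where the derivative has locally maximal rank, each vector in its kernel is the velocity of a
curve in the fibre. -/
theorem exists_curve_in_fibre [FiniteDimensional ℝ F] {f : E → F} (hf : ContDiff ℝ 1 f) {p : E}
    (hr : ∀ᶠ x in 𝓝 p, Module.finrank ℝ (fderiv ℝ f x : E →ₗ[ℝ] F).range ≤
      Module.finrank ℝ (fderiv ℝ f p : E →ₗ[ℝ] F).range)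
    {v : E} (hv : fderiv ℝ f p v = 0) :
    ∃ γ : ℝ → E, γ 0 = p ∧ HasDerivAt γ v 0 ∧ ∀ᶠ t in 𝓝 0, f (γ t) = f p := by
  set L : E →L[ℝ] F := fderiv ℝ f p with hL
  obtain ⟨J₀, hJ₀⟩ := LinearMap.exists_comp_comp_eq_self (L : E →ₗ[ℝ] F)
  set J : F →L[ℝ] E := LinearMap.toContinuousLinearMap J₀
  have hLJL : ∀ x, L (J (L x)) = L x := fun x => LinearMap.congr_fun hJ₀ x
  have hfd : Differentiable ℝ f := hf.differentiable one_ne_zero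
  -- A local change of coordinates: its derivative at `p` is the identity, and `L ∘ Ψ = L ∘ J ∘ f`
  -- because `L J L = L`.
  set Ψ : E → E := fun x => x + J (f x - L x) with hΨ
  have hΨc : ContDiff ℝ 1 Ψ := by fun_prop
  have hΨ' : HasFDerivAt Ψ ((ContinuousLinearEquiv.refl ℝ E : E ≃L[ℝ] E) : E →L[ℝ] E) p := by
    have h := (hasFDerivAt_id (𝕜 := ℝ) p).add
      (J.hasFDerivAt.comp p ((hfd p).hasFDerivAt.sub L.hasFDerivAt))
    have h0 : ((ContinuousLinearEquiv.refl ℝ E : E ≃L[ℝ] E) : E →L[ℝ] E) =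
        ContinuousLinearMap.id ℝ E + J ∘L (fderiv ℝ f p - L) := by
      ext x
      simp [← hL]
    rw [h0]
    exact h
  have hstr := hΨc.contDiffAt.hasStrictFDerivAt' hΨ' one_ne_zero
  set Φ := hΨc.contDiffAt.localInverse hΨ' one_ne_zero with hΦ
  have hΦc : ContDiffAt ℝ 1 Φ (Ψ p) := hΨc.contDiffAt.to_localInverse hΨ' one_ne_zero
  have hΦp : Φ (Ψ p) = p := hΨc.contDiffAt.localInverse_apply_image hΨ' one_ne_zero
  have hΨΦ : ∀ᶠ y in 𝓝 (Ψ p), Ψ (Φ y) = y := hstr.eventually_right_inverse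
  have hΦ' : HasFDerivAt Φ (ContinuousLinearMap.id ℝ E) (Ψ p) := by
    exact hstr.to_localInverse.hasFDerivAt
  -- `L` is constant on this line since `L v = 0`; hence `L ∘ J ∘ f` is constant on its pullback
  -- under `Ψ`, the desired curve.
  set ℓ : ℝ → E := fun t => Ψ p + t • v with hℓ
  have hℓc : Continuous ℓ := by fun_prop
  have hℓ0 : ℓ 0 = Ψ p := by simp [hℓ]
  have hℓt : Tendsto ℓ (𝓝 0) (𝓝 (Ψ p)) := by simpa [hℓ0] using hℓc.tendsto 0
  have hℓ' : ∀ t, HasDerivAt ℓ v t := fun t => by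
    have h := ((hasDerivAt_id t).smul_const v).const_add (Ψ p)
    rwa [one_smul] at h
  refine ⟨Φ ∘ ℓ, by simp [hℓ0, hΦp], ?_, ?_⟩
  · have h1 : HasFDerivAt Φ (ContinuousLinearMap.id ℝ E) (ℓ 0) := by rwa [hℓ0]
    simpa using h1.comp_hasDerivAt 0 (hℓ' 0)
  have hγt : Tendsto (Φ ∘ ℓ) (𝓝 0) (𝓝 p) := by
    have := hΦc.continuousAt.tendsto
    rw [hΦp] at this
    exact this.comp hℓt
  have hdiff : ∀ᶠ t in 𝓝 0, DifferentiableAt ℝ (Φ ∘ ℓ) t := by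
    have h1 : ∀ᶠ y in 𝓝 (Ψ p), ContDiffAt ℝ 1 Φ y := hΦc.eventually (by simp)
    filter_upwards [hℓt.eventually h1] with t ht
    exact (ht.differentiableAt one_ne_zero).comp t (hℓ' t).differentiableAt
  -- Near `p`, `L ∘ J` is injective on the range of `fderiv ℝ f x`: the composite has rank at least
  -- that of `L`, and by `hr` the derivative has no more.
  have hker : ∀ᶠ x in 𝓝 p, ∀ w, L (J (fderiv ℝ f x w)) = 0 → fderiv ℝ f x w = 0 := by
    have hc : ContinuousAt (fun x => (L ∘L J) ∘L fderiv ℝ f x) p := by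
      have := (hf.continuous_fderiv one_ne_zero).continuousAt (x := p)
      fun_prop
    filter_upwards [hr, eventually_finrank_range_le hc] with x hx hx' w hw
    have hp : (L ∘L J) ∘L fderiv ℝ f p = L := ContinuousLinearMap.ext fun y => hLJL y
    rw [hp] at hx'
    have := LinearMap.ker_comp_eq_of_finrank_range_le (fderiv ℝ f x : E →ₗ[ℝ] F)
      ((L ∘L J : F →L[ℝ] F) : F →ₗ[ℝ] F) (hx.trans hx')
    have hw' : w ∈ (((L ∘L J : F →L[ℝ] F) : F →ₗ[ℝ] F) ∘ₗ (fderiv ℝ f x : E →ₗ[ℝ] F)).ker := hw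
    rw [this] at hw'
    exact hw'
  have hconst : ∀ᶠ t in 𝓝 0, L (J (f ((Φ ∘ ℓ) t))) = L (Ψ p) := by
    filter_upwards [hℓt.eventually hΨΦ] with t ht
    have h1 : L (Ψ (Φ (ℓ t))) = L (J (f (Φ (ℓ t)))) := by simp [hΨ, hLJL]
    rw [Function.comp_apply, ← h1, ht]
    simp [hℓ, hv]
  have hzero : ∀ᶠ t in 𝓝 0, DifferentiableAt ℝ (f ∘ Φ ∘ ℓ) t ∧ deriv (f ∘ Φ ∘ ℓ) t = 0 := by
    filter_upwards [hdiff, hγt.eventually hker, hconst.eventually_nhds] with t hd hk hc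
    have h1 : HasDerivAt (f ∘ Φ ∘ ℓ) (fderiv ℝ f ((Φ ∘ ℓ) t) (deriv (Φ ∘ ℓ) t)) t :=
      (hfd _).hasFDerivAt.comp_hasDerivAt t hd.hasDerivAt
    have h2 := (L ∘L J).hasFDerivAt.comp_hasDerivAt t h1
    have h3 : HasDerivAt ((L ∘L J) ∘ f ∘ Φ ∘ ℓ) 0 t :=
      (hasDerivAt_const t (L (Ψ p))).congr_of_eventuallyEq hc
    exact ⟨h1.differentiableAt, by rw [h1.deriv]; exact hk _ (h2.unique h3)⟩
  obtain ⟨ε, hε, hball⟩ := Metric.eventually_nhds_iff_ball.1 hzero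
  filter_upwards [Metric.ball_mem_nhds (0 : ℝ) hε] with t ht
  have := Metric.isOpen_ball.is_const_of_deriv_eq_zero
    (convex_ball (0 : ℝ) ε).isPreconnected
    (fun s hs => (hball s hs).1.differentiableWithinAt) (fun s hs => (hball s hs).2) ht
    (Metric.mem_ball_self hε)
  simpa [hℓ0, hΦp] using this

end ConstantRank

/-! ### Maximal rank at generic points -/

section GenericRank

open scoped Matrix

/-- A matrix over `ℝ` has a set of rows, as many as its rank, with nonzero Gram determinant. -/
theorem Matrix.exists_det_submatrix_mul_transpose_ne_zero {m n : Type*} [Finite m] [Fintype n]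
    (A : Matrix m n ℝ) :
    ∃ s : Fin A.rank → m, ((A.submatrix s id) * (A.submatrix s id)ᵀ).det ≠ 0 := by
  rw [A.rank_eq_finrank_span_row]
  obtain ⟨f, hf, -, hli⟩ := Submodule.exists_fun_fin_finrank_span_eq ℝ (Set.range A.row)
  choose s hs using hf
  refine ⟨s, ?_⟩
  have hrow : (A.submatrix s id).row = f := funext hs
  have hr : ((A.submatrix s id) * (A.submatrix s id)ᵀ).rank = Fintype.card
      (Fin (Module.finrank ℝ (Submodule.span ℝ (Set.range A.row)))) := by
    -- Over `ℝ`, `A * Aᵀ` has the rank of `A`, so a Gram determinant detects independent rows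
    -- without a choice of columns.
    rw [Matrix.rank_self_mul_transpose]
    exact LinearIndependent.rank_matrix (by rwa [hrow])
  intro h0
  have hli' : LinearIndependent ℝ ((A.submatrix s id) * (A.submatrix s id)ᵀ).row :=
    linearIndependent_iff_card_eq_finrank_span.2
      (hr.symm.trans (Matrix.rank_eq_finrank_span_row _))
  exact ((Matrix.isUnit_iff_isUnit_det _).1
    (Matrix.linearIndependent_rows_iff_isUnit.1 hli')).ne_zero h0

/-- A matrix over `ℝ` has rank at least `r` if some `r` rows have nonzero Gram determinant. -/
theorem Matrix.le_rank_of_det_submatrix_mul_transpose_ne_zero {m n : Type*} [Finite m] [Fintype n]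
    (A : Matrix m n ℝ) {r : ℕ} (s : Fin r → m)
    (h : ((A.submatrix s id) * (A.submatrix s id)ᵀ).det ≠ 0) : r ≤ A.rank := by
  have hr := Matrix.rank_of_isUnit _ ((Matrix.isUnit_iff_isUnit_det _).2 (isUnit_iff_ne_zero.2 h))
  rw [Matrix.rank_self_mul_transpose, Fintype.card_fin] at hr
  rw [← hr, Matrix.rank_eq_finrank_span_row, A.rank_eq_finrank_span_row]
  refine Submodule.finrank_mono (Submodule.span_mono ?_)
  rintro _ ⟨i, rfl⟩
  exact ⟨s i, rfl⟩

/-- A matrix with polynomial entries attains its maximal rank at each generic point. -/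
theorem AlgebraicIndependent.rank_le_rank {σ m n : Type*} [Finite m] [Fintype n]
    {x : σ → ℝ} (hx : AlgebraicIndependent ℚ x) (P : Matrix m n (MvPolynomial σ ℚ)) (y : σ → ℝ) :
    (P.map (MvPolynomial.aeval y)).rank ≤ (P.map (MvPolynomial.aeval x)).rank := by
  obtain ⟨s, hs⟩ := (P.map (MvPolynomial.aeval y)).exists_det_submatrix_mul_transpose_ne_zero
  have key : ∀ z : σ → ℝ, (((P.map (MvPolynomial.aeval z)).submatrix s id) *
      ((P.map (MvPolynomial.aeval z)).submatrix s id)ᵀ).det =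
      MvPolynomial.aeval z ((P.submatrix s id) * (P.submatrix s id)ᵀ).det := by
    intro z
    rw [AlgHom.map_det, AlgHom.mapMatrix_apply, Matrix.map_mul]
    rfl
  refine Matrix.le_rank_of_det_submatrix_mul_transpose_ne_zero _ s ?_
  rw [key] at hs ⊢
  -- The Gram determinant is a single polynomial over `ℚ`; vanishing at the generic `x`, it would be
  -- zero and vanish at `y` too.
  intro h0
  rw [(map_eq_zero_iff _ hx).1 h0, map_zero] at hs
  exact hs rfl

end GenericRank

/-! ### The rigidity function, its derivative and the rigidity matrix -/

namespace AngleGraph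

variable {d n : ℕ}

theorem hasFDerivAt_normSq_sub (p : Configuration d n) (i j : Fin n) :
    HasFDerivAt (fun q : Configuration d n => ‖q i - q j‖ ^ 2)
      (2 • (innerSL ℝ (p i - p j)).comp
        ((ContinuousLinearMap.proj i : Configuration d n →L[ℝ] EuclideanSpace ℝ (Fin d)) -
          ContinuousLinearMap.proj j)) p :=
  HasFDerivAt.norm_sq (f := fun q : Configuration d n => q i - q j)
    (((ContinuousLinearMap.proj i : Configuration d n →L[ℝ] EuclideanSpace ℝ (Fin d)) -
      ContinuousLinearMap.proj j).hasFDerivAt)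

theorem fderiv_rigidityFunction_mk (G : AngleGraph n) (p v : Configuration d n) {i j : Fin n}
    (h : G.edges.Adj i j) :
    fderiv ℝ (fun q : Configuration d n => G.rigidityFunction q ⟨s(i, j), h⟩) p v =
      2 * inner ℝ (p i - p j) (v i - v j) := by
  have := (hasFDerivAt_normSq_sub p i j).fderiv
  change fderiv ℝ (fun q : Configuration d n => ‖q i - q j‖ ^ 2) p v = _
  rw [this]
  simp [inner_sub_left, inner_sub_right]

theorem contDiff_rigidityFunction_apply (G : AngleGraph n) (e : G.edges.edgeSet) :
    ContDiff ℝ 1 (fun q : Configuration d n => G.rigidityFunction q e) := by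
  obtain ⟨e, he⟩ := e
  induction e with | _ i j
  change ContDiff ℝ 1 (fun q : Configuration d n => ‖q i - q j‖ ^ 2)
  have h : ContDiff ℝ 1 (fun q : Configuration d n => q i - q j) := by fun_prop
  exact h.norm_sq ℝ

/-- The configuration with the given coordinates. -/
def ofCoordinates (d n : ℕ) : (Fin n × Fin d → ℝ) ≃ₗ[ℝ] Configuration d n :=
  (LinearEquiv.curry ℝ ℝ (Fin n) (Fin d)).trans
    (LinearEquiv.piCongrRight fun _ => (WithLp.linearEquiv 2 ℝ (Fin d → ℝ)).symm)

theorem ofCoordinates_apply (x : Fin n × Fin d → ℝ) (i : Fin n) (k : Fin d) :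
    ofCoordinates d n x i k = x (i, k) := rfl

theorem ofCoordinates_single (c : Fin n × Fin d) :
    ofCoordinates d n (Pi.single c 1) = Pi.single c.1 (EuclideanSpace.single c.2 1) := by
  ext i k
  rw [ofCoordinates_apply]
  by_cases hi : i = c.1
  · subst hi
    simp [Pi.single_apply, Prod.ext_iff]
  · simp [Prod.ext_iff, hi]

section Fintype

variable (G : AngleGraph n) [Fintype G.edges.edgeSet]

theorem contDiff_rigidityFunction : ContDiff ℝ 1 (G.rigidityFunction (d := d)) :=
  contDiff_pi.2 G.contDiff_rigidityFunction_apply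

theorem fderiv_rigidityFunction_apply (p v : Configuration d n) (e : G.edges.edgeSet) :
    fderiv ℝ G.rigidityFunction p v e =
      fderiv ℝ (fun q : Configuration d n => G.rigidityFunction q e) p v := by
  rw [fderiv_apply (G.contDiff_rigidityFunction.differentiable one_ne_zero p)]
  rfl

theorem fderiv_rigidityFunction_eq_zero_iff (p v : Configuration d n) :
    fderiv ℝ G.rigidityFunction p v = 0 ↔
      ∀ i j, G.edges.Adj i j → inner ℝ (p i - p j) (v i - v j) = 0 := by
  rw [funext_iff]
  constructor
  · intro h i j hij
    have := h ⟨s(i, j), hij⟩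
    rw [fderiv_rigidityFunction_apply, fderiv_rigidityFunction_mk G p v hij] at this
    simpa using this
  · rintro h ⟨e, he⟩
    induction e with | _ i j
    rw [fderiv_rigidityFunction_apply, fderiv_rigidityFunction_mk G p v he, h i j he]
    simp

theorem rank_rigidityMatrix (p : Configuration d n) :
    (G.rigidityMatrix p).rank =
      Module.finrank ℝ
        (fderiv ℝ G.rigidityFunction p : Configuration d n →ₗ[ℝ] G.edges.edgeSet → ℝ).range := by
  have h : (G.rigidityMatrix p).mulVecLin = (1 / 2 : ℝ) •
      ((fderiv ℝ G.rigidityFunction p : Configuration d n →ₗ[ℝ] G.edges.edgeSet → ℝ) ∘ₗ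
        (ofCoordinates d n).toLinearMap) := by
    refine (Pi.basisFun ℝ (Fin n × Fin d)).ext fun c => ?_
    ext e
    simp [ofCoordinates_single, fderiv_rigidityFunction_apply, rigidityMatrix]
  rw [Matrix.rank, h, LinearMap.range_smul _ _ (by norm_num),
    LinearMap.range_comp_of_range_eq_top _ (ofCoordinates d n).range]

/-- Two configurations have the same edge lengths iff their difference is an infinitesimal flex of
their midpoint. -/
theorem rigidityFunction_eq_iff (p q : Configuration d n) :
    G.rigidityFunction p = G.rigidityFunction q ↔
      fderiv ℝ G.rigidityFunction ((1 / 2 : ℝ) • (p + q)) (p - q) = 0 := by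
  -- Polarisation: `⟨a + b, a - b⟩ = ‖a‖² - ‖b‖²` for the edge vectors `a` of `p` and `b` of `q`.
  have key : ∀ i j, inner ℝ (((1 / 2 : ℝ) • (p + q)) i - ((1 / 2 : ℝ) • (p + q)) j)
      ((p - q) i - (p - q) j) = (1 / 2) * (‖p i - p j‖ ^ 2 - ‖q i - q j‖ ^ 2) := by
    intro i j
    have h1 : ((1 / 2 : ℝ) • (p + q)) i - ((1 / 2 : ℝ) • (p + q)) j =
        (1 / 2 : ℝ) • ((p i - p j) + (q i - q j)) := by
      simp only [Pi.smul_apply, Pi.add_apply]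
      module
    have h2 : (p - q) i - (p - q) j = (p i - p j) - (q i - q j) := by
      simp only [Pi.sub_apply]
      abel
    rw [h1, h2, real_inner_smul_left, inner_add_left, inner_sub_right (p i - p j),
      inner_sub_right (q i - q j), real_inner_self_eq_norm_sq, real_inner_self_eq_norm_sq, real_inner_comm (q i - q j)]
    ring
  rw [fderiv_rigidityFunction_eq_zero_iff, funext_iff]
  constructor
  · intro h i j hij
    rw [key]
    have : ‖p i - p j‖ ^ 2 = ‖q i - q j‖ ^ 2 := h ⟨s(i, j), hij⟩
    rw [this]
    ring
  · rintro h ⟨e, he⟩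
    induction e with | _ i j
    have := h i j he
    rw [key] at this
    change ‖p i - p j‖ ^ 2 = ‖q i - q j‖ ^ 2
    linarith

end Fintype

/-- The rank of the rigidity matrix is maximal at a generic configuration. -/
theorem rank_rigidityMatrix_le_of_isGeneric (G : AngleGraph n) {p : Configuration d n}
    (hp : p.IsGeneric) (q : Configuration d n) :
    (G.rigidityMatrix q).rank ≤ (G.rigidityMatrix p).rank := by
  have hP : ∀ (e : G.edges.edgeSet) (c : Fin n × Fin d), ∃ P : MvPolynomial (Fin n × Fin d) ℚ,
      ∀ q : Configuration d n,
        G.rigidityMatrix q e c = MvPolynomial.aeval (fun c : Fin n × Fin d => q c.1 c.2) P := by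
    rintro ⟨e, he⟩ ⟨k, l⟩
    induction e with | _ i j
    refine ⟨(MvPolynomial.X (i, l) - MvPolynomial.X (j, l)) *
      ((if i = k then 1 else 0) - (if j = k then 1 else 0)), fun q => ?_⟩
    simp only [rigidityMatrix, Matrix.of_apply]
    rw [fderiv_rigidityFunction_mk G q _ he]
    by_cases hi : i = k <;> by_cases hj : j = k <;>
      simp [hi, hj, EuclideanSpace.inner_single_right]
  choose P hP using hP
  have h : ∀ q, G.rigidityMatrix q =
      (Matrix.of P).map (MvPolynomial.aeval (fun c : Fin n × Fin d => q c.1 c.2)) :=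
    fun q => Matrix.ext fun e c => hP e c q
  rw [h, h]
  exact AlgebraicIndependent.rank_le_rank hp _ _

/-! ### The rank of the complete graph -/

section Complete

variable {d n m : ℕ}

/-- The complete graph without angles. -/
def complete (n : ℕ) : AngleGraph n where
  edges := ⊤
  angles := ∅
  angles_distinct := by intro k i j h; exact absurd h (Set.notMem_empty _)

theorem rigidityFunction_complete_eq_iff (p q : Configuration d n) :
    (complete n).rigidityFunction p = (complete n).rigidityFunction q ↔
      ∀ i j, ‖p i - p j‖ = ‖q i - q j‖ := by
  rw [funext_iff]
  constructor
  · intro h i j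
    by_cases hij : i = j
    · simp [hij]
    · have : ‖p i - p j‖ ^ 2 = ‖q i - q j‖ ^ 2 := h ⟨s(i, j), hij⟩
      exact (sq_eq_sq₀ (norm_nonneg _) (norm_nonneg _)).1 this
  · rintro h ⟨e, he⟩
    induction e with | _ i j
    change ‖p i - p j‖ ^ 2 = ‖q i - q j‖ ^ 2
    rw [h]

/-- The infinitesimal flexes of the complete graph. -/
theorem mem_ker_fderiv_complete_iff [Fintype (complete n).edges.edgeSet] (p v : Configuration d n) :
    v ∈ (fderiv ℝ (complete n).rigidityFunction p :
        Configuration d n →ₗ[ℝ] (complete n).edges.edgeSet → ℝ).ker ↔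
      ∀ i j, inner ℝ (p i - p j) (v i - v j) = 0 := by
  rw [LinearMap.mem_ker, ContinuousLinearMap.coe_coe, fderiv_rigidityFunction_eq_zero_iff]
  refine forall₂_congr fun i j => ⟨fun h => ?_, fun h _ => h⟩
  by_cases hij : i = j
  · simp [hij]
  · exact h hij

/-- In both main implications equality of these kernels is what links `G` to the complete graph. -/
theorem ker_fderiv_complete_le (G : AngleGraph n) [Fintype G.edges.edgeSet]
    [Fintype (complete n).edges.edgeSet] (p : Configuration d n) :
    (fderiv ℝ (complete n).rigidityFunction p :
        Configuration d n →ₗ[ℝ] (complete n).edges.edgeSet → ℝ).ker ≤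
      (fderiv ℝ G.rigidityFunction p : Configuration d n →ₗ[ℝ] G.edges.edgeSet → ℝ).ker := by
  intro v hv
  rw [mem_ker_fderiv_complete_iff] at hv
  rw [LinearMap.mem_ker, ContinuousLinearMap.coe_coe, fderiv_rigidityFunction_eq_zero_iff]
  exact fun i j _ => hv i j

theorem finrank_configuration : Module.finrank ℝ (Configuration d n) = d * n := by
  simp [Configuration, Module.finrank_pi_fintype, mul_comm]

theorem rank_add_finrank_ker (G : AngleGraph n) [Fintype G.edges.edgeSet]
    (p : Configuration d n) :
    (G.rigidityMatrix p).rank + Module.finrank ℝ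
      (fderiv ℝ G.rigidityFunction p : Configuration d n →ₗ[ℝ] G.edges.edgeSet → ℝ).ker =
      d * n := by
  rw [rank_rigidityMatrix, LinearMap.finrank_range_add_finrank_ker, finrank_configuration]

/-- The velocities of the infinitesimal rigid motions of a configuration in space, given by a
translation and a rotation vector. -/
def infinitesimalMotion (p : Configuration 3 n) :
    (Fin 3 → ℝ) × (Fin 3 → ℝ) →ₗ[ℝ] Configuration 3 n where
  toFun x i := WithLp.toLp 2 (x.1 + crossProduct x.2 (WithLp.ofLp (p i)))
  map_add' x y := by
    ext i k
    simp
    ring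
  map_smul' c x := by
    ext i k
    simp

theorem inner_infinitesimalMotion (p : Configuration 3 n) (x : (Fin 3 → ℝ) × (Fin 3 → ℝ))
    (i j : Fin n) :
    inner ℝ (p i - p j) (infinitesimalMotion p x i - infinitesimalMotion p x j) = 0 := by
  simp [infinitesimalMotion, PiLp.inner_apply, Fin.sum_univ_three, cross_apply]
  ring

/-- The minor of the coordinates `k`, `l` of the edge vectors from `a` to `b` and from `a` to `c`. -/
def planarMinor (p : Configuration d n) (a b c : Fin n) (k l : Fin d) : ℝ :=
  (p b k - p a k) * (p c l - p a l) - (p b l - p a l) * (p c k - p a k)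

/-- If the motion vanishes at `a`, `b`, `c`, the rotation vector has zero cross product with two
independent edge vectors, so it is zero, and then so is the translation. -/
theorem injective_infinitesimalMotion {p : Configuration 3 n} {a b c : Fin n}
    (h : planarMinor p a b c 0 1 ≠ 0) :
    Function.Injective (infinitesimalMotion p) := by
  rw [← LinearMap.ker_eq_bot, LinearMap.ker_eq_bot']
  rintro ⟨t, w⟩ hx
  have hc : ∀ i k, (t + crossProduct w (WithLp.ofLp (p i))) k = 0 := by
    intro i k
    have : infinitesimalMotion p (t, w) i k = 0 := by rw [hx]; rfl
    exact this
  have e : ∀ i, (t 0 + (w 1 * p i 2 - w 2 * p i 1) = 0) ∧ (t 1 + (w 2 * p i 0 - w 0 * p i 2) = 0) ∧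
      (t 2 + (w 0 * p i 1 - w 1 * p i 0) = 0) := by
    intro i
    refine ⟨?_, ?_, ?_⟩
    · simpa [cross_apply] using hc i 0
    · simpa [cross_apply] using hc i 1
    · simpa [cross_apply] using hc i 2
  obtain ⟨a0, a1, a2⟩ := e a
  obtain ⟨b0, b1, b2⟩ := e b
  obtain ⟨c0, c1, c2⟩ := e c
  have w0 : w 0 = 0 := by
    refine (mul_eq_zero.1 (?_ : w 0 * planarMinor p a b c 0 1 = 0)).resolve_right h
    unfold planarMinor
    linear_combination (p b 0 - p a 0) * (c2 - a2) - (p c 0 - p a 0) * (b2 - a2)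
  have w1 : w 1 = 0 := by
    refine (mul_eq_zero.1 (?_ : w 1 * planarMinor p a b c 0 1 = 0)).resolve_right h
    unfold planarMinor
    linear_combination (p b 1 - p a 1) * (c2 - a2) - (p c 1 - p a 1) * (b2 - a2)
  have w2 : w 2 = 0 := by
    refine (mul_eq_zero.1 (?_ : w 2 * planarMinor p a b c 0 1 = 0)).resolve_right h
    rw [w0] at a1 b1 c1
    rw [w1] at a0 b0 c0
    unfold planarMinor
    linear_combination (b1 - a1) * (p c 1 - p a 1) - (p b 1 - p a 1) * (c1 - a1)
  simp only [w0, w1, w2, zero_mul, sub_zero, add_zero] at a0 a1 a2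
  refine Prod.ext (funext fun k => ?_) (funext fun k => ?_)
  · fin_cases k <;> assumption
  · fin_cases k <;> assumption

theorem rank_complete_add_six_le {p : Configuration 3 n} {a b c : Fin n}
    (h : planarMinor p a b c 0 1 ≠ 0) : ((complete n).rigidityMatrix p).rank + 6 ≤ 3 * n := by
  have := Fintype.ofFinite (complete n).edges.edgeSet
  rw [← rank_add_finrank_ker (complete n) p]
  have h6 : Module.finrank ℝ ((Fin 3 → ℝ) × (Fin 3 → ℝ)) = 6 := by simp
  rw [← h6]
  gcongr
  rw [← LinearMap.finrank_range_of_inj (injective_infinitesimalMotion h)]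
  refine Submodule.finrank_mono ?_
  rintro _ ⟨x, rfl⟩
  rw [mem_ker_fderiv_complete_iff]
  exact inner_infinitesimalMotion p x

/-- The first three points are the origin and two unit vectors, all others are at the third unit
vector. -/
def cornerConfiguration (m : ℕ) : Configuration 3 (m + 3) := fun i =>
  if i = 0 then 0 else if i = 1 then EuclideanSpace.single 0 1
    else if i = 2 then EuclideanSpace.single 1 1 else EuclideanSpace.single 2 1

/-- One explicit configuration suffices for the lower bound, since generic rank is maximal. -/
theorem le_rank_complete_cornerConfiguration (m : ℕ) :
    3 * (m + 3) ≤ ((complete (m + 3)).rigidityMatrix (cornerConfiguration m)).rank + 6 := by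
  have := Fintype.ofFinite (complete (m + 3)).edges.edgeSet
  rw [← rank_add_finrank_ker (complete (m + 3)) (cornerConfiguration m)]
  gcongr
  set N := (fderiv ℝ (complete (m + 3)).rigidityFunction (cornerConfiguration m) :
        Configuration 3 (m + 3) →ₗ[ℝ] (complete (m + 3)).edges.edgeSet → ℝ).ker with hN
  -- Pinning: vertex `0` is fixed, vertex `1` may move only along its axis, vertex `2` only in the
  -- plane of the first two axes. A flex so pinned vanishes on the triangle `0, 1, 2`, whose edges
  -- then hold every other vertex.
  let Φ : Configuration 3 (m + 3) →ₗ[ℝ] (Fin 6 → ℝ) :=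
    { toFun := fun v => ![v 0 0, v 0 1, v 0 2, v 1 1, v 1 2, v 2 2]
      map_add' := fun v w => by ext k; fin_cases k <;> rfl
      map_smul' := fun a v => by ext k; fin_cases k <;> rfl }
  have hinj : Function.Injective (Φ.domRestrict N) := by
    rw [← LinearMap.ker_eq_bot, LinearMap.ker_eq_bot']
    rintro ⟨v, hv⟩ hΦ
    have hΦ' : Φ v = 0 := hΦ
    rw [hN, mem_ker_fderiv_complete_iff] at hv
    have f00 : v 0 0 = 0 := congrFun hΦ' 0
    have f01 : v 0 1 = 0 := congrFun hΦ' 1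
    have f02 : v 0 2 = 0 := congrFun hΦ' 2
    have f11 : v 1 1 = 0 := congrFun hΦ' 3
    have f12 : v 1 2 = 0 := congrFun hΦ' 4
    have f22 : v 2 2 = 0 := congrFun hΦ' 5
    have n2 : 2 % (m + 3) = 2 := Nat.mod_eq_of_lt (by omega)
    have n21 : (2 : Fin (m + 3)) ≠ 1 := by simp [Fin.ext_iff, n2]
    have n20 : (2 : Fin (m + 3)) ≠ 0 := by simp [Fin.ext_iff, n2]
    have c0 : cornerConfiguration m 0 = 0 := by simp [cornerConfiguration]
    have c1 : cornerConfiguration m 1 = EuclideanSpace.single 0 1 := by simp [cornerConfiguration]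
    have c2 : cornerConfiguration m 2 = EuclideanSpace.single 1 1 := by
      simp [cornerConfiguration, n21, n20]
    have h10 := hv 1 0
    have h20 := hv 2 0
    have h21 := hv 2 1
    simp [c0, c1, c2, PiLp.inner_apply, Fin.sum_univ_three, f00, f01, f11, f12, f22]
      at h10 h20 h21
    have hz : ∀ i k, v i k = 0 := by
      intro i
      by_cases i0 : i = 0
      · subst i0
        intro k
        fin_cases k <;> assumption
      by_cases i1 : i = 1
      · subst i1
        intro k
        fin_cases k <;> assumption
      by_cases i2 : i = 2
      · subst i2
        intro k
        fin_cases k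
        · change v 2 0 = 0
          linarith
        · exact h20
        · exact f22
      have ci : cornerConfiguration m i = EuclideanSpace.single 2 1 := by
        simp [cornerConfiguration, i0, i1, i2]
      have hi0 := hv i 0
      have hi1 := hv i 1
      have hi2 := hv i 2
      simp [ci, c0, c1, c2, PiLp.inner_apply, Fin.sum_univ_three, f02, f11, f12, f22]
        at hi0 hi1 hi2
      intro k
      fin_cases k
      · change v i 0 = 0
        linarith
      · change v i 1 = 0
        linarith
      · exact hi0
    refine Subtype.ext (funext fun i => ?_)
    ext k
    exact hz i k
  simpa using LinearMap.finrank_le_finrank_of_injective hinj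

theorem planarMinor_ne_zero_of_isGeneric {p : Configuration d n} (hp : p.IsGeneric)
    {a b c : Fin n} (hab : a ≠ b) (hac : a ≠ c) (hbc : b ≠ c) {k l : Fin d} (hkl : k ≠ l) :
    planarMinor p a b c k l ≠ 0 := by
  set P : MvPolynomial (Fin n × Fin d) ℚ :=
    (.X (b, k) - .X (a, k)) * (.X (c, l) - .X (a, l)) -
      (.X (b, l) - .X (a, l)) * (.X (c, k) - .X (a, k)) with hP
  have h : planarMinor p a b c k l = MvPolynomial.aeval (fun c : Fin n × Fin d => p c.1 c.2) P := by
    simp [hP, planarMinor]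
  rw [h, Ne, map_eq_zero_iff _ hp]
  intro h0
  -- The minor equals `1` when `a` is at the origin, `b` at the `k`-th and `c` at the `l`-th unit
  -- vector.
  have := congrArg (MvPolynomial.eval
    (Function.update (Function.update 0 (b, k) 1) (c, l) 1)) h0
  simp [hP, hab, hac, hbc, hkl, hkl.symm, hbc.symm] at this

/-- A generic framework on a complete graph is infinitesimally rigid. -/
theorem rank_complete_of_isGeneric (hn : 3 ≤ n) {p : Configuration 3 n} (hp : p.IsGeneric) :
    ((complete n).rigidityMatrix p).rank + 6 = 3 * n := by
  obtain ⟨m, rfl⟩ := Nat.exists_eq_add_of_le' hn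
  have n2 : 2 % (m + 3) = 2 := Nat.mod_eq_of_lt (by omega)
  have h : planarMinor p 0 1 2 0 1 ≠ 0 :=
    planarMinor_ne_zero_of_isGeneric hp (by simp) (by simp [Fin.ext_iff, n2])
      (by simp [Fin.ext_iff, n2]) (by simp)
  refine (rank_complete_add_six_le h).antisymm ((le_rank_complete_cornerConfiguration m).trans ?_)
  gcongr
  exact rank_rigidityMatrix_le_of_isGeneric _ hp _

end Complete

/-! ### Weak rigidity and infinitesimal flexes -/

section Rigidity

variable {d n : ℕ}

/-- Strong equivalence means that the edges of the induced graph have equal lengths. -/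
theorem stronglyEquivalent_iff_rigidityFunction_induced {G : AngleGraph n} (hG : G.AnglesOnEdges)
    (p q : Configuration d n) :
    G.StronglyEquivalent p q ↔ G.induced.rigidityFunction p = G.induced.rigidityFunction q := by
  constructor
  · rintro ⟨hE, hA⟩
    have key : ∀ i j, (G.edges.Adj i j ∨ ∃ k, (k, i, j) ∈ G.angles) →
        ‖p i - p j‖ ^ 2 = ‖q i - q j‖ ^ 2 := by
      rintro i j (h | ⟨k, h⟩)
      · rw [hE i j h]
      · have h1 := EuclideanGeometry.law_cos (p i) (p k) (p j)
        have h2 := EuclideanGeometry.law_cos (q i) (q k) (q j)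
        simp only [dist_eq_norm] at h1 h2
        rw [hE _ _ (hG k i j h).1, hE _ _ (hG k i j h).2, hA k i j h, ← h2] at h1
        simpa only [sq] using h1
    funext ⟨e, he⟩
    induction e with | _ i j
    change ‖p i - p j‖ ^ 2 = ‖q i - q j‖ ^ 2
    rcases he.2 with h | h
    · exact key i j h
    · rw [norm_sub_rev, norm_sub_rev (q i)]
      exact key j i h
  · intro h
    have key : ∀ i j, i ≠ j → (G.edges.Adj i j ∨ ∃ k, (k, i, j) ∈ G.angles) →
        ‖p i - p j‖ = ‖q i - q j‖ := by
      intro i j hne hij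
      have h' : ‖p i - p j‖ ^ 2 = ‖q i - q j‖ ^ 2 :=
        congrFun h ⟨s(i, j), hne, Or.inl hij⟩
      exact (sq_eq_sq₀ (norm_nonneg _) (norm_nonneg _)).1 h'
    refine ⟨fun v w hvw => key v w hvw.ne (Or.inl hvw), fun k i j hk => ?_⟩
    have h1 := key i k (hG k i j hk).1.ne (Or.inl (hG k i j hk).1)
    have h2 := key j k (hG k i j hk).2.ne (Or.inl (hG k i j hk).2)
    have h3 := key i j (G.angles_distinct k i j hk).2.2 (Or.inr ⟨k, hk⟩)
    -- The three lengths determine the inner product at `k`, hence the angle as defined by `arccos`;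
    -- coincident points need no separate case.
    rw [← sub_sub_sub_cancel_right (p i) (p j) (p k),
      ← sub_sub_sub_cancel_right (q i) (q j) (q k)] at h3
    simp only [EuclideanGeometry.angle, vsub_eq_sub, InnerProductGeometry.angle]
    rw [real_inner_eq_norm_mul_self_add_norm_mul_self_sub_norm_sub_mul_self_div_two,
      real_inner_eq_norm_mul_self_add_norm_mul_self_sub_norm_sub_mul_self_div_two, h1, h2, h3]

theorem weaklyRigid_iff_eventually {G : AngleGraph n} (hG : G.AnglesOnEdges)
    (p : Configuration d n) :
    G.WeaklyRigid p ↔ ∀ᶠ q in 𝓝 p, G.induced.rigidityFunction p = G.induced.rigidityFunction q →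
      (complete n).rigidityFunction p = (complete n).rigidityFunction q := by
  simp only [WeaklyRigid, stronglyEquivalent_iff_rigidityFunction_induced hG,
    ← rigidityFunction_complete_eq_iff]
  exact Filter.eventually_iff_exists_mem.symm

/-- A framework whose rigidity matrix has the rank of the complete graph, which is maximal there,
is rigid. -/
theorem eventually_rigid_of_rank_eq (H : AngleGraph n) {p : Configuration d n}
    (hmax : ∀ q : Configuration d n,
      ((complete n).rigidityMatrix q).rank ≤ ((complete n).rigidityMatrix p).rank)
    (h : (H.rigidityMatrix p).rank = ((complete n).rigidityMatrix p).rank) :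
    ∀ᶠ q in 𝓝 p, H.rigidityFunction p = H.rigidityFunction q →
      (complete n).rigidityFunction p = (complete n).rigidityFunction q := by
  have := Fintype.ofFinite (complete n).edges.edgeSet
  have := Fintype.ofFinite H.edges.edgeSet
  have hm : Filter.Tendsto (fun q : Configuration d n => (1 / 2 : ℝ) • (p + q)) (𝓝 p) (𝓝 p) := by
    have hc : Continuous (fun q : Configuration d n => (1 / 2 : ℝ) • (p + q)) := by fun_prop
    have hp : (1 / 2 : ℝ) • (p + p) = p := by module
    simpa only [hp] using hc.tendsto p
  have hc := ((H.contDiff_rigidityFunction (d := d)).continuous_fderiv one_ne_zero).continuousAt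
    (x := p)
  filter_upwards [hm.eventually (eventually_finrank_range_le hc)] with q hq
  simp only [← rank_rigidityMatrix] at hq
  rw [rigidityFunction_eq_iff, rigidityFunction_eq_iff]
  intro hk
  set x := (1 / 2 : ℝ) • (p + q)
  -- At the midpoint `x`: rank of `H` at `x` ≥ rank of `H` at `p` = rank of `K` at `p` ≥ rank of `K`
  -- at `x`, so the kernel inclusion is an equality.
  have hker := Submodule.eq_of_le_of_finrank_le (ker_fderiv_complete_le H x) (by
    have h1 := rank_add_finrank_ker H x
    have h2 := rank_add_finrank_ker (complete n) x
    have h3 := hmax x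
    omega)
  have hk' : p - q ∈ (fderiv ℝ H.rigidityFunction x :
    Configuration d n →ₗ[ℝ] H.edges.edgeSet → ℝ).ker := hk
  rw [← hker] at hk'
  exact hk'

/-- If the rigidity matrix has locally maximal rank, a rigid framework has no other infinitesimal
flexes than the complete graph. -/
theorem rank_eq_of_eventually_rigid (H : AngleGraph n) {p : Configuration d n}
    (hmax : ∀ q : Configuration d n, (H.rigidityMatrix q).rank ≤ (H.rigidityMatrix p).rank)
    (h : ∀ᶠ q in 𝓝 p, H.rigidityFunction p = H.rigidityFunction q →
      (complete n).rigidityFunction p = (complete n).rigidityFunction q) :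
    (H.rigidityMatrix p).rank = ((complete n).rigidityMatrix p).rank := by
  have := Fintype.ofFinite (complete n).edges.edgeSet
  have := Fintype.ofFinite H.edges.edgeSet
  have hker : (fderiv ℝ (complete n).rigidityFunction p :
      Configuration d n →ₗ[ℝ] (complete n).edges.edgeSet → ℝ).ker =
      (fderiv ℝ H.rigidityFunction p : Configuration d n →ₗ[ℝ] H.edges.edgeSet → ℝ).ker := by
    refine (ker_fderiv_complete_le H p).antisymm fun v hv => ?_
    obtain ⟨γ, hγ0, hγ', hγ⟩ := exists_curve_in_fibre (H.contDiff_rigidityFunction (d := d))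
      (p := p) (.of_forall fun x => by simpa only [← rank_rigidityMatrix] using hmax x) hv
    have hγt : Filter.Tendsto γ (𝓝 0) (𝓝 p) := by
      simpa only [hγ0] using hγ'.continuousAt.tendsto
    have hd := ((complete n).contDiff_rigidityFunction.differentiable one_ne_zero
      (γ 0)).hasFDerivAt.comp_hasDerivAt 0 hγ'
    have hc : HasDerivAt ((complete n).rigidityFunction ∘ γ) 0 0 := by
      refine (hasDerivAt_const 0 ((complete n).rigidityFunction p)).congr_of_eventuallyEq ?_
      filter_upwards [hγt.eventually h, hγ] with t ht hft
      exact (ht hft.symm).symm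
    have := hd.unique hc
    rwa [hγ0] at this
  have h1 := rank_add_finrank_ker H p
  have h2 := rank_add_finrank_ker (complete n) p
  rw [hker] at h2
  omega

end Rigidity

end AngleGraph

end

theorem mainTheorem8 (n : ℕ) (hn : 3 ≤ n) (G : AngleGraph n) (hG : G.AnglesOnEdges)
    (p : Configuration 3 n) (hp : Configuration.IsGeneric p) :
    G.WeaklyRigid p ↔ (G.induced.rigidityMatrix p).rank = 3 * n - 6 := by
  have hK : ((AngleGraph.complete n).rigidityMatrix p).rank = 3 * n - 6 := by
    have := AngleGraph.rank_complete_of_isGeneric hn hp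
    omega
  rw [AngleGraph.weaklyRigid_iff_eventually hG, ← hK]
  -- Genericity serves the induced graph in the first implication and the complete graph in the
  -- second.
  exact ⟨AngleGraph.rank_eq_of_eventually_rigid _
      (AngleGraph.rank_rigidityMatrix_le_of_isGeneric _ hp),
    AngleGraph.eventually_rigid_of_rank_eq _
      (AngleGraph.rank_rigidityMatrix_le_of_isGeneric _ hp)⟩
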